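/- A plane tree is a finite rooted tree in which the children of every vertex are linearly ordered; unlabeled plane trees are counted up to isomorphism. The degree of a vertex is the number of its children, and a leaf is a vertex of degree $0$. We use the convention $\binom{a}{b}=0$ for $b<0$. (1) (Narayana) For all integers $n\ge 1$ and $p\ge 0$, the number of unlabeled plane trees on $n+1$ vertices with exactly $p$ leaves equals $$\frac{1}{n+1}\binom{n+1}{p}\binom{n-1}{n-p}.$$ (2) (Erdélyi–Etherington) Let $n\ge 1$ and $m\ge 0$ be integers, let $n_1,\dots,n_m$ be nonnegative integers with $n_1+2n_2+\cdots+mn_m=n-1$, and put $n_0=n-(n_1+\cdots+n_m)$. Then the number of unlabeled plane trees on $n$ vertices having exactly $n_i$ vertices of degree $i$ for every $0\le i\le m$ equals $$\frac{1}{n}\binom{n}{n_0,n_1,\ldots,n_m}=\frac1n\cdot\frac{n!}{n_0!\,n_1!\cdots n_m!}.$$ -/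

import Mathlib

/-- Unlabeled plane trees (finite rooted trees in which the children of every vertex are
linearly ordered, up to isomorphism): such a tree is a root together with the finite, possibly
empty, list of the plane trees hanging from its children, in order. -/
inductive PlaneTree : Type
  | node (children : List PlaneTree) : PlaneTree

namespace PlaneTree

/-- The number of vertices of a plane tree. -/
def numVertices : PlaneTree → ℕ
  | node ts => 1 + (ts.map numVertices).sum

/-- The number of vertices of degree `d`, the degree of a vertex being its number of children. -/
def numOfDegree (d : ℕ) : PlaneTree → ℕ
  | node ts => (if ts.length = d then 1 else 0) + (ts.map (numOfDegree d)).sum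

/-- The number of leaves; a leaf is a vertex of degree zero (the root included, if it has no
children). -/
def numLeaves (t : PlaneTree) : ℕ := t.numOfDegree 0

end PlaneTree

/-! Both formulas are the case `k = 1` of statements about forests of `k` trees. Deleting the root
of the first tree, of degree `d`, turns a forest with `n + 1` vertices and `k + 1` trees into one
with `n` vertices and `k + d` trees, and `graft d` undoes this. The resulting recurrence
(`card_filter_forests_succ`) proves by induction on `n` that `n` times the number of forests is `k`
times the number of admissible degree sequences of length `n`, as in the cycle lemma. That number is
a multinomial coefficient for prescribed degrees; for `p` leaves, one chooses the leaf positions and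
a composition of the number of edges. -/

namespace PlaneTree

/-- The total number of vertices of a plane forest. -/
def forestVertices (l : List PlaneTree) : ℕ := (l.map numVertices).sum

/-- The number of vertices of degree `d` of a plane forest. -/
def forestDegree (d : ℕ) (l : List PlaneTree) : ℕ := (l.map (numOfDegree d)).sum

/-- Join the first `d` trees of a forest under a new root. -/
def graft (d : ℕ) (l : List PlaneTree) : List PlaneTree := node (l.take d) :: l.drop d

open Classical in
/-- The plane forests with `n` vertices (first argument) and `k` trees (second argument). -/
noncomputable def forests : ℕ → ℕ → Finset (List PlaneTree)
  | 0, 0 => {[]}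
  | 0, _ + 1 => ∅
  | _ + 1, 0 => ∅
  -- The bound is `d ≤ n - k`: the `k + d` remaining trees need at least as many vertices.
  | n + 1, k + 1 => (Finset.range (n + 1 - k)).biUnion fun d => (forests n (k + d)).image (graft d)

theorem numVertices_pos (t : PlaneTree) : 0 < t.numVertices := by
  cases t with | node ts => rw [numVertices]; omega

theorem length_le_forestVertices (l : List PlaneTree) : l.length ≤ forestVertices l := by
  induction l with
  | nil => simp
  | cons t l ih =>
    have := numVertices_pos t
    simp only [forestVertices, List.map_cons, List.sum_cons, List.length_cons] at ih ⊢
    omega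

theorem forestVertices_cons_node (ts r : List PlaneTree) :
    forestVertices (node ts :: r) = forestVertices (ts ++ r) + 1 := by
  simp only [forestVertices, List.map_cons, List.sum_cons, numVertices, List.map_append,
    List.sum_append]
  omega

theorem forestDegree_cons_node (i : ℕ) (ts r : List PlaneTree) :
    forestDegree i (node ts :: r) = forestDegree i (ts ++ r) + if ts.length = i then 1 else 0 := by
  simp only [forestDegree, List.map_cons, List.sum_cons, numOfDegree, List.map_append,
    List.sum_append]
  omega

theorem forestVertices_graft (d : ℕ) (l : List PlaneTree) :
    forestVertices (graft d l) = forestVertices l + 1 := by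
  rw [graft, forestVertices_cons_node, List.take_append_drop]

theorem forestDegree_graft (i : ℕ) {d : ℕ} {l : List PlaneTree} (h : d ≤ l.length) :
    forestDegree i (graft d l) = forestDegree i l + if d = i then 1 else 0 := by
  rw [graft, forestDegree_cons_node, List.take_append_drop, List.length_take, min_eq_left h]

theorem graft_injective (d : ℕ) : Function.Injective (graft d) := by
  intro l l' h
  simp only [graft, List.cons.injEq, node.injEq] at h
  rw [← List.take_append_drop d l, h.1, h.2, List.take_append_drop]

theorem mem_forests {n k : ℕ} {l : List PlaneTree} :
    l ∈ forests n k ↔ forestVertices l = n ∧ l.length = k := by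
  induction n generalizing k l with
  | zero =>
    have h := length_le_forestVertices l
    cases k with
    | zero =>
      rw [forests, Finset.mem_singleton]
      constructor
      · rintro rfl; simp [forestVertices]
      · exact fun h => List.length_eq_zero_iff.1 h.2
    | succ k => simp only [forests, Finset.notMem_empty, false_iff]; omega
  | succ n ih =>
    cases k with
    | zero =>
      simp only [forests, Finset.notMem_empty, false_iff, List.length_eq_zero_iff]
      rintro ⟨h, rfl⟩
      simp [forestVertices] at h
    | succ k =>
      simp only [forests, Finset.mem_biUnion, Finset.mem_range, Finset.mem_image, ih]
      constructor
      · rintro ⟨d, -, l, ⟨hv, hl⟩, rfl⟩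
        rw [forestVertices_graft, hv]
        simp [graft, hl]
      · rintro ⟨hv, hl⟩
        match l, hl with
        | node ts :: r, hl =>
          rw [forestVertices_cons_node] at hv
          have := length_le_forestVertices (ts ++ r)
          simp only [List.length_append, List.length_cons] at this hl
          refine ⟨ts.length, by omega, ts ++ r, ⟨by omega, ?_⟩, by simp [graft]⟩
          simp only [List.length_append]
          omega

open Classical in
/-- Removing the root of the first tree of a forest. -/
theorem card_filter_forests_succ (n k : ℕ) (P : List PlaneTree → Prop) [DecidablePred P] :
    ((forests (n + 1) (k + 1)).filter P).card =
      ∑ d ∈ Finset.range (n + 1 - k),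
        ((forests n (k + d)).filter fun l => P (graft d l)).card := by
  rw [forests, Finset.filter_biUnion, Finset.card_biUnion]
  · refine Finset.sum_congr rfl fun d _ => ?_
    rw [Finset.filter_image, Finset.card_image_of_injective _ (graft_injective d)]
  · intro d _ e _ hde
    rw [Function.onFun, Finset.disjoint_left]
    intro x hx hx'
    simp only [Finset.mem_filter, Finset.mem_image, mem_forests] at hx hx'
    obtain ⟨⟨l, ⟨-, hl⟩, rfl⟩, -⟩ := hx
    obtain ⟨⟨l', ⟨-, hl'⟩, h⟩, -⟩ := hx'
    simp only [graft, List.cons.injEq, node.injEq] at h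
    have := congrArg List.length h.1
    simp only [List.length_take] at this
    omega

/-- Each vertex has one degree, so it is counted at most once. This later excludes root degrees
outside `S`. -/
theorem sum_forestDegree_le (S : Finset ℕ) {n k : ℕ} {l : List PlaneTree}
    (hl : l ∈ forests n k) : ∑ i ∈ S, forestDegree i l ≤ n := by
  induction n generalizing k l with
  | zero =>
    have h := mem_forests.1 hl
    have := length_le_forestVertices l
    obtain rfl : l = [] := List.length_eq_zero_iff.1 (by omega)
    simp [forestDegree]
  | succ n ih =>
    cases k with
    | zero => simp [forests] at hl
    | succ k =>
      simp only [forests, Finset.mem_biUnion, Finset.mem_image] at hl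
      obtain ⟨d, -, l, hl, rfl⟩ := hl
      have hd : d ≤ l.length := by have := (mem_forests.1 hl).2; omega
      simp only [forestDegree_graft _ hd, Finset.sum_add_distrib, Finset.sum_ite_eq]
      have := ih hl
      split_ifs <;> omega

/-- The number of plane trees satisfying a property, in terms of one-tree forests. -/
theorem finite_and_ncard_eq_card_filter_forests (n : ℕ) (P : List PlaneTree → Prop)
    [DecidablePred P] :
    {t : PlaneTree | t.numVertices = n ∧ P [t]}.Finite ∧
    {t : PlaneTree | t.numVertices = n ∧ P [t]}.ncard = ((forests n 1).filter P).card := by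
  have hinj : Function.Injective fun t : PlaneTree => [t] := fun a b h => by simpa using h
  have h : (fun t : PlaneTree => [t]) '' {t | t.numVertices = n ∧ P [t]} =
      ((forests n 1).filter P : Finset (List PlaneTree)) := by
    ext l
    simp only [Set.mem_image, Set.mem_ofPred_eq, Finset.coe_filter, mem_forests,
      List.length_eq_one_iff]
    constructor
    · rintro ⟨t, ⟨h, hP⟩, rfl⟩
      exact ⟨⟨by simpa [forestVertices] using h, t, rfl⟩, hP⟩
    · rintro ⟨⟨h, t, rfl⟩, hP⟩
      exact ⟨t, ⟨by simpa [forestVertices] using h, hP⟩, rfl⟩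
  refine ⟨Set.Finite.of_finite_image (h ▸ Finset.finite_toSet _) hinj.injOn, ?_⟩
  rw [← Set.ncard_image_of_injective _ hinj, h, Set.ncard_coe_finset]

/-! ### Compositions and forests by leaves -/

/-- The number of ways to write `s` as an ordered sum of `m` positive integers. -/
def numCompositions : ℕ → ℕ → ℕ
  | 0, 0 => 1
  | 0, _ + 1 => 0
  | _ + 1, 0 => 0
  | m + 1, s + 1 => s.choose m

theorem numCompositions_succ_succ (m s : ℕ) :
    numCompositions (m + 1) (s + 1) = numCompositions (m + 1) s + numCompositions m s := by
  cases m <;> cases s <;> simp [numCompositions, Nat.choose_succ_succ, add_comm]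

/-- Split by the first part, `d + 1`. -/
theorem sum_numCompositions (m s : ℕ) :
    ∑ d ∈ Finset.range s, numCompositions m (s - 1 - d) = numCompositions (m + 1) s := by
  rw [Finset.sum_range_reflect (numCompositions m) s]
  induction s with
  | zero => rfl
  | succ s ih => rw [Finset.sum_range_succ, ih, numCompositions_succ_succ]

/-- This is the sum of the first parts over all compositions of `s` into `m + 1` parts. -/
theorem sum_succ_mul_numCompositions (m s : ℕ) :
    ∑ d ∈ Finset.range s, (d + 1) * numCompositions m (s - 1 - d) = s.choose (m + 1) := by
  induction s with
  | zero => simp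
  | succ s ih =>
    have h := sum_numCompositions m (s + 1)
    rw [Finset.sum_range_succ'] at h ⊢
    have e : ∀ d, s + 1 - 1 - (d + 1) = s - 1 - d := fun d => by omega
    simp only [e] at h ⊢
    simp only [add_one_mul (_ + 1 : ℕ), Finset.sum_add_distrib]
    rw [ih]
    simp only [add_tsub_cancel_right, Nat.sub_zero, zero_add, one_mul] at h ⊢
    rw [numCompositions] at h
    rw [Nat.choose_succ_succ']
    omega

/-- By symmetry, the first part averages `s / (m + 1)`. -/
theorem succ_mul_choose_succ (m s : ℕ) :
    (m + 1) * s.choose (m + 1) = s * numCompositions (m + 1) s := by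
  cases s with
  | zero => simp
  | succ s => rw [numCompositions, mul_comm, ← Nat.add_one_mul_choose_eq]

/-- Forests with `k` trees, `n` vertices and `p` leaves. -/
theorem mul_card_forests_leaves (n k s p : ℕ) (hn : n = k + s) :
    n * ((forests n k).filter fun l => forestDegree 0 l = p).card =
      k * (n.choose p * numCompositions (n - p) s) := by
  -- Here `s` counts edges, shared among the `n - p` non-leaves with at least one each.
  induction n generalizing k s p with
  | zero => obtain rfl : k = 0 := by omega
            simp
  | succ n ih =>
    cases k with
    | zero => simp [forests]
    | succ k =>
      have hs : n + 1 - k = s + 1 := by omega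
      rw [card_filter_forests_succ, hs, Finset.sum_range_succ']
      have h0 : ((forests n (k + 0)).filter fun l => forestDegree 0 (graft 0 l) = p).card =
          ((forests n k).filter fun l => forestDegree 0 l + 1 = p).card := by
        congr 1
        refine Finset.filter_congr fun l _ => ?_
        rw [forestDegree_graft _ (Nat.zero_le _), if_pos rfl]
      have hd : ∀ d, ((forests n (k + (d + 1))).filter
          fun l => forestDegree 0 (graft (d + 1) l) = p).card =
          ((forests n (k + (d + 1))).filter fun l => forestDegree 0 l = p).card := fun d => by
        congr 1
        refine Finset.filter_congr fun l hl => ?_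
        rw [forestDegree_graft _ (by have := (mem_forests.1 hl).2; omega),
          if_neg (Nat.succ_ne_zero d), add_zero]
      simp only [h0, hd]
      rcases Nat.eq_zero_or_pos n with rfl | hpos
      · obtain ⟨rfl, rfl⟩ : k = 0 ∧ s = 0 := by omega
        rcases p with _ | _ | p <;>
          simp [forests, Finset.filter_singleton, forestDegree, numCompositions, Nat.choose_eq_zero_of_lt]
      -- The weight splits as `k + (d + 1)`, one summation lemma for each summand.
      have hsum : n * ∑ d ∈ Finset.range s,
          ((forests n (k + (d + 1))).filter fun l => forestDegree 0 l = p).card =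
          n.choose p * (k * numCompositions (n - p + 1) s + s.choose (n - p + 1)) := by
        rw [← sum_numCompositions, ← sum_succ_mul_numCompositions, Finset.mul_sum,
          Finset.mul_sum, ← Finset.sum_add_distrib, Finset.mul_sum]
        refine Finset.sum_congr rfl fun d hd => ?_
        rw [Finset.mem_range] at hd
        rw [ih (k + (d + 1)) (s - 1 - d) p (by omega)]
        ring
      refine Nat.eq_of_mul_eq_mul_left hpos ?_
      have hleaf : (n + 1) * (n * ((forests n k).filter fun l => forestDegree 0 l + 1 = p).card) =
          p * (n + 1).choose p * (k * numCompositions (n + 1 - p) s) := by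
        cases p with
        | zero => simp
        | succ p =>
          simp only [add_left_inj]
          rw [ih k s p (by omega), Nat.add_sub_add_right, mul_comm (p + 1),
            ← Nat.add_one_mul_choose_eq]
          ring
      rw [mul_left_comm n, mul_add n, hsum, mul_add (n + 1), hleaf]
      rcases Nat.lt_trichotomy p (n + 1) with hp | rfl | hp
      · obtain ⟨m, rfl⟩ := Nat.exists_eq_add_of_le (Nat.le_of_lt_succ hp)
        have hchoose := Nat.choose_mul_succ_eq (p + m) p
        have hcomp := succ_mul_choose_succ m s
        rw [show p + m + 1 - p = m + 1 by omega] at hchoose ⊢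
        rw [show p + m - p = m by omega]
        have hpm : p + m = k + s := by omega
        rw [← mul_assoc, mul_comm (p + m + 1), hchoose]
        calc _ = (p + m + 1).choose p * ((m + 1) * k * numCompositions (m + 1) s +
              (m + 1) * s.choose (m + 1) + p * k * numCompositions (m + 1) s) := by ring
          _ = (p + m + 1).choose p * numCompositions (m + 1) s *
              ((p + m) * k + k + s) := by rw [hcomp]; ring
          _ = _ := by rw [add_assoc (_ * k), ← hpm]; ring
      -- All vertices are leaves, so there can be no edges.
      · cases s with
        | zero => obtain rfl : n = k := by omega
                  simp; ring
        | succ s => simp [numCompositions]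
      · simp [Nat.choose_eq_zero_of_lt hp, Nat.choose_eq_zero_of_lt (show n < p by omega)]

/-! ### Forests by degree sequence -/

/-- Lowering one entry of a multinomial coefficient. -/
theorem sum_mul_multinomial_update {S : Finset ℕ} {c : ℕ → ℕ} {d : ℕ} (hd : d ∈ S)
    (hpos : 0 < c d) :
    (∑ i ∈ S, c i) * Nat.multinomial S (Function.update c d (c d - 1)) =
      c d * Nat.multinomial S c := by
  have h := Nat.multinomial_spec S c
  have h' := Nat.multinomial_spec S (Function.update c d (c d - 1))
  have hfac : ∀ i, (Function.update c d (c d - 1) i).factorial =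
      Function.update (fun i => (c i).factorial) d (c d - 1).factorial i := fun i => by
    by_cases hi : i = d
    · subst hi; simp
    · simp [hi]
  simp only [hfac] at h'
  rw [Finset.prod_update_of_mem hd, Finset.sum_update_of_mem hd] at h'
  rw [← Finset.mul_prod_erase S _ hd] at h
  have hsum := Finset.add_sum_erase S c hd
  rw [← Finset.erase_eq] at h'
  rw [show ∑ i ∈ S, c i = (c d - 1 + ∑ i ∈ S.erase d, c i) + 1 by omega] at h ⊢
  rw [Nat.factorial_succ, ← h', ← Nat.mul_factorial_pred hpos.ne'] at h
  have hP : 0 < (c d - 1).factorial * ∏ i ∈ S.erase d, (c i).factorial :=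
    Nat.mul_pos (Nat.factorial_pos _) (Finset.prod_pos fun i _ => Nat.factorial_pos _)
  refine Nat.eq_of_mul_eq_mul_left hP ?_
  linarith

/-- Forests with `k` trees and prescribed numbers of vertices of each degree. -/
theorem mul_card_forests_degrees (S : Finset ℕ) (n k : ℕ) (c : ℕ → ℕ)
    (hc : ∑ i ∈ S, c i = n) (hk : k + ∑ i ∈ S, i * c i = n) :
    n * ((forests n k).filter fun l => ∀ i ∈ S, forestDegree i l = c i).card =
      k * Nat.multinomial S c := by
  induction n generalizing k c with
  | zero => obtain rfl : k = 0 := by omega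
            simp
  | succ n ih =>
    cases k with
    | zero => simp [forests]
    | succ k =>
      have hle : ∀ d ∈ S, d * c d ≤ ∑ i ∈ S, i * c i := fun d hd =>
        Finset.single_le_sum (f := fun i => i * c i) (fun _ _ => Nat.zero_le _) hd
      rw [card_filter_forests_succ]
      rcases Nat.eq_zero_or_pos n with rfl | hpos
      · obtain rfl : k = 0 := by omega
        have hzero : ∀ i ∈ S, i ≠ 0 → c i = 0 := fun i hi h0 =>
          (Nat.mul_eq_zero.1 (Nat.le_zero.1 ((hle i hi).trans (by omega)))).resolve_left h0
        have hmult := Nat.multinomial_spec S c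
        rw [hc] at hmult
        rw [Nat.eq_one_of_mul_eq_one_left hmult]
        have h1 : ∀ i ∈ S, (if 0 = i then 1 else 0) = c i := by
          intro i hi
          split_ifs with h
          · subst h
            rw [← Finset.sum_eq_single_of_mem 0 hi fun i hi h => hzero i hi h, hc]
          · exact (hzero i hi (Ne.symm h)).symm
        have h2 : ∀ i ∈ S, forestDegree i (graft 0 []) = c i := fun i hi => by
          rw [forestDegree_graft i (Nat.zero_le _), ← h1 i hi]
          simp [forestDegree]
        simp [forests, Finset.filter_singleton, if_pos h2]
      -- The factor `n` serves the induction hypothesis, and `n + 1` the lowering of `c d` in the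
      -- multinomial.
      have hterm : ∀ d, (n + 1) * n * ((forests n (k + d)).filter
          fun l => ∀ i ∈ S, forestDegree i (graft d l) = c i).card =
          if d ∈ S then c d * (k + d) * Nat.multinomial S c else 0 := by
        intro d
        have hlen : ∀ l ∈ forests n (k + d), d ≤ l.length := fun l hl => by
          have := (mem_forests.1 hl).2
          omega
        split_ifs with hd
        · rcases Nat.eq_zero_or_pos (c d) with h0 | h0
          · rw [Finset.filter_false_of_mem]
            · simp [h0]
            · intro l hl h
              have := h d hd
              rw [forestDegree_graft d (hlen l hl), if_pos rfl] at this
              omega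
          · have hS := Finset.add_sum_erase S c hd
            have hS' := Finset.add_sum_erase S (fun i => i * c i) hd
            have hfilter : ((forests n (k + d)).filter
                fun l => ∀ i ∈ S, forestDegree i (graft d l) = c i) =
                (forests n (k + d)).filter
                  fun l => ∀ i ∈ S, forestDegree i l = Function.update c d (c d - 1) i := by
              refine Finset.filter_congr fun l hl => forall₂_congr fun i _ => ?_
              rw [forestDegree_graft i (hlen l hl)]
              by_cases hi : i = d
              · subst hi; simp; omega
              · simp [hi, Ne.symm hi]
            have herase : ∀ i ∈ S.erase d, Function.update c d (c d - 1) i = c i :=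
              fun i hi => Function.update_of_ne (Finset.ne_of_mem_erase hi) _ _
            have hdc : d * (c d - 1) + d = d * c d := by
              rw [← Nat.mul_add_one, Nat.sub_add_cancel h0]
            have hih := ih (k + d) (Function.update c d (c d - 1))
              (by
                rw [← Finset.add_sum_erase S _ hd, Finset.sum_congr rfl herase,
                  Function.update_self]
                change c d - 1 + ∑ i ∈ S.erase d, c i = n
                omega)
              (by
                rw [← Finset.add_sum_erase S _ hd,
                  Finset.sum_congr rfl fun i hi => by rw [herase i hi], Function.update_self]
                omega)
            have hmult := sum_mul_multinomial_update hd h0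
            rw [hc] at hmult
            rw [hfilter, mul_assoc, hih, mul_left_comm, hmult]
            ring
        -- A root of degree outside `S` would leave `n` vertices to supply all `n + 1` prescribed
        -- degrees.
        · rw [Finset.filter_false_of_mem, Finset.card_empty, mul_zero]
          intro l hl h
          have hsum := sum_forestDegree_le S hl
          have heq : ∑ i ∈ S, forestDegree i l = ∑ i ∈ S, c i := by
            refine Finset.sum_congr rfl fun i hi => ?_
            rw [← h i hi, forestDegree_graft i (hlen l hl), if_neg, add_zero]
            rintro rfl
            exact hd hi
          omega
      refine Nat.eq_of_mul_eq_mul_left hpos ?_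
      rw [← mul_assoc, mul_comm n, Finset.mul_sum, Finset.sum_congr rfl fun d _ => hterm d,
        Finset.sum_ite_mem, Finset.sum_subset Finset.inter_subset_right, ← Finset.sum_mul,
        ← mul_assoc]
      -- `∑ c d * (k + d) = (n + 1) * k + (n - k) = n * (k + 1)`.
      · congr 1
        simp only [mul_add, Finset.sum_add_distrib, ← Finset.sum_mul, hc]
        simp only [mul_comm (c _)]
        have : ∑ i ∈ S, i * c i + k = n := by omega
        linarith
      -- Degrees beyond the range have `c d = 0`, since `d * c d ≤ n - k`.
      · intro d hd hd'
        have hdn : n + 1 - k ≤ d := by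
          simp only [Finset.mem_inter, Finset.mem_range, not_and] at hd'
          by_contra h
          exact hd' (by omega) hd
        have h := hle d hd
        rcases Nat.eq_zero_or_pos (c d) with h0 | h0
        · simp [h0]
        · have := Nat.le_mul_of_pos_right d h0
          omega

end PlaneTree

theorem mainTheorem12 :
    -- Narayana; a binomial coefficient with negative lower index is zero
    (∀ n p : ℕ, 1 ≤ n →
      {t : PlaneTree | t.numVertices = n + 1 ∧ t.numLeaves = p}.Finite ∧
      ({t : PlaneTree | t.numVertices = n + 1 ∧ t.numLeaves = p}.ncard : ℚ) =
        1 / ((n : ℚ) + 1) * ((n + 1).choose p : ℚ) *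
          (if p ≤ n then ((n - 1).choose (n - p) : ℚ) else 0)) ∧
    -- Erdélyi–Etherington; `c i` is the prescribed number of vertices of degree `i`
    (∀ (n m : ℕ) (c : ℕ → ℕ), 1 ≤ n →
      ∑ i ∈ Finset.Icc 1 m, i * c i = n - 1 →
      c 0 + ∑ i ∈ Finset.Icc 1 m, c i = n →
      {t : PlaneTree | t.numVertices = n ∧
        ∀ i ∈ Finset.range (m + 1), t.numOfDegree i = c i}.Finite ∧
      ({t : PlaneTree | t.numVertices = n ∧
        ∀ i ∈ Finset.range (m + 1), t.numOfDegree i = c i}.ncard : ℚ) =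
        1 / (n : ℚ) * (Nat.multinomial (Finset.range (m + 1)) c : ℚ)) := by
  have hdeg : ∀ i (t : PlaneTree), PlaneTree.forestDegree i [t] = t.numOfDegree i :=
    fun i t => by simp [PlaneTree.forestDegree]
  constructor
  · intro n p hn
    obtain ⟨hfin, hcard⟩ := PlaneTree.finite_and_ncard_eq_card_filter_forests (n + 1)
      fun l => PlaneTree.forestDegree 0 l = p
    have h := PlaneTree.mul_card_forests_leaves (n + 1) 1 n p (by omega)
    rw [← hcard, one_mul] at h
    simp only [hdeg] at hfin h
    refine ⟨hfin, ?_⟩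
    have hcomp : ((n + 1).choose p * PlaneTree.numCompositions (n + 1 - p) n : ℚ) =
        (n + 1).choose p * (if p ≤ n then ((n - 1).choose (n - p) : ℚ) else 0) := by
      obtain ⟨n, rfl⟩ := Nat.exists_eq_succ_of_ne_zero (show n ≠ 0 by omega)
      split_ifs with hp
      · rw [Nat.sub_add_comm hp]
        rfl
      · rcases Nat.eq_or_lt_of_le (show n.succ + 1 ≤ p by omega) with rfl | hp'
        · simp [PlaneTree.numCompositions]
        · simp [Nat.choose_eq_zero_of_lt hp']
    have hq : ((n : ℚ) + 1) ≠ 0 := by positivity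
    rw [mul_assoc, ← hcomp, one_div, eq_inv_mul_iff_mul_eq₀ hq]
    exact_mod_cast h
  · intro n m c hn hsum htot
    obtain ⟨hfin, hcard⟩ := @PlaneTree.finite_and_ncard_eq_card_filter_forests n
      (fun l => ∀ i ∈ Finset.range (m + 1), PlaneTree.forestDegree i l = c i)
      (fun _ => Finset.decidableDforallFinset)
    have hrange : ∀ f : ℕ → ℕ, ∑ i ∈ Finset.range (m + 1), f i =
        f 0 + ∑ i ∈ Finset.Icc 1 m, f i := fun f => by
      rw [Finset.sum_range_eq_add_Ico _ (Nat.succ_pos m)]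
      rfl
    have h := PlaneTree.mul_card_forests_degrees (Finset.range (m + 1)) n 1 c
      (by rw [hrange, htot]) (by rw [hrange, hsum]; omega)
    rw [← hcard, one_mul] at h
    simp only [hdeg] at hfin h
    refine ⟨hfin, ?_⟩
    have hq : (n : ℚ) ≠ 0 := by positivity
    rw [one_div, eq_inv_mul_iff_mul_eq₀ hq]
    exact_mod_cast h
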